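/- Let $K$ be a field and let $\Gamma$ be a pointed affine semigroup, that is, a finitely generated, cancellative, torsion-free commutative semigroup with origin $0$ in which $0$ is the only invertible element. Let $K[[\Gamma]]$ be the ring of all formal power series $f=\sum_{m\in\Gamma}a_m\chi^m$ with $a_m\in K$; a *monomial* is an element $c\,\chi^m$ with $m\in\Gamma$ and $c\in K\setminus\{0\}$. Let $M(\Gamma)$ be the group of formal differences of elements of $\Gamma$, $N(\Gamma)$ its dual lattice, and let $\sigma(\Gamma)\subset N(\Gamma)_{\mathbb R}$ be the cone of all $w$ with $\langle w,x\rangle\ge 0$ for every $x$ in the cone generated by $\Gamma$ in $M(\Gamma)_{\mathbb R}$. For $w\in\sigma(\Gamma)$ and $0\neq f=\sum a_m\chi^m$, put $w(f)=\min\{\langle w,m\rangle : a_m\neq 0\}$ and $\operatorname{in}_w(f)=\sum_{\langle w,m\rangle=w(f)}a_m\chi^m$ (and $\operatorname{in}_w(0)=0$); for an ideal $I$, $\operatorname{in}_w(I)$ is the ideal of $K[[\Gamma]]$ generated by all $\operatorname{in}_w(f)$, $f\in I$. A *local monomial ordering* is a total order $\preceq$ on $\Gamma$, compatible with addition, with least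 element $0$; $\operatorname{in}_\preceq(f)$ is the $\preceq$-least monomial $\chi^m$ with $a_m\ne 0$ (and $\operatorname{in}_\preceq(0)=0$), and $\operatorname{in}_\preceq(I)$ is the ideal generated by all $\operatorname{in}_\preceq(f)$, $f\in I$. A *universal standard basis* of $I$ is a finite subset of $I$ whose initial monomials generate $\operatorname{in}_\preceq(I)$ for every local monomial ordering $\preceq$. A *tropical basis* of $I$ is a universal standard basis $\{f_1,\dots,f_p\}$ of $I$ such that for every $w\in\sigma(\Gamma)$ the ideal $\operatorname{in}_w(I)$ contains a monomial if and only if one of $\operatorname{in}_w(f_1),\dots,\operatorname{in}_w(f_p)$ is a monomial. **Theorem.** Every ideal of $K[[\Gamma]]$ has a tropical basis. -/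

import Mathlib

open scoped TensorProduct

/-- A commutative additive monoid `Γ` is a *pointed affine semigroup* if it is finitely generated,
cancellative, torsion-free, and `0` is its only invertible element. -/
class PointedAffine (Γ : Type*) [AddCommMonoid Γ] : Prop
    extends IsCancelAdd Γ, IsAddTorsionFree Γ, AddMonoid.FG Γ where
  /-- `0` is the only invertible element. -/
  eq_zero_of_add_eq_zero : ∀ a b : Γ, a + b = 0 → a = 0

namespace PointedAffine

variable {Γ : Type*} [AddCommMonoid Γ] [PointedAffine Γ]

/-- An element of a pointed affine semigroup is a sum of two elements in finitely many ways. -/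
theorem finite_antidiagonal (m : Γ) : {p : Γ × Γ | p.1 + p.2 = m}.Finite := by
  classical
  obtain ⟨S, hS⟩ := (AddMonoid.FG.fg_top : (⊤ : AddSubmonoid Γ).FG)
  let T : Finset Γ := S.erase 0
  let φ : (T → ℕ) → Γ := fun u => ∑ t : T, u t • (t : Γ)
  have φ_add (u v : T → ℕ) : φ (u + v) = φ u + φ v := by
    simp only [φ, Pi.add_apply, add_smul, Finset.sum_add_distrib]
  have φ_zero : φ 0 = 0 := by simp [φ]
  have φ_surj (a : Γ) : ∃ u, φ u = a := by
    have ha : a ∈ AddSubmonoid.closure (S : Set Γ) := by rw [hS]; trivial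
    induction ha using AddSubmonoid.closure_induction with
    | mem x hx =>
      by_cases h0 : x = 0
      · exact ⟨0, by rw [φ_zero, h0]⟩
      · refine ⟨Pi.single ⟨x, Finset.mem_erase.2 ⟨h0, hx⟩⟩ 1, ?_⟩
        simp only [φ]
        rw [Finset.sum_eq_single ⟨x, Finset.mem_erase.2 ⟨h0, hx⟩⟩]
        · simp
        · intro b _ hb
          simp [hb]
        · simp
    | zero => exact ⟨0, φ_zero⟩
    | add x y _ _ hx hy =>
      obtain ⟨u, rfl⟩ := hx
      obtain ⟨v, rfl⟩ := hy
      exact ⟨u + v, φ_add u v⟩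
  have φ_eq_zero (u : T → ℕ) (hu : φ u = 0) : u = 0 := by
    funext t
    by_contra ht
    obtain ⟨k, hk⟩ := Nat.exists_eq_succ_of_ne_zero ht
    have h1 : (t : Γ) + (k • (t : Γ) + ∑ s ∈ Finset.univ.erase t, u s • (s : Γ)) = 0 := by
      rw [← hu]
      simp only [φ]
      rw [← Finset.add_sum_erase _ _ (Finset.mem_univ t), hk, Nat.succ_eq_add_one, add_smul,
        one_smul]
      abel
    exact (Finset.mem_erase.1 t.2).1 (PointedAffine.eq_zero_of_add_eq_zero _ _ h1)
  have hfib : {u : T → ℕ | φ u = m}.Finite := by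
    apply WellQuasiOrderedLE.finite_of_isAntichain
    intro u hu v hv huv hle
    apply huv
    obtain ⟨d, rfl⟩ := exists_add_of_le hle
    have h : φ u + φ d = φ u + 0 := by
      rw [← φ_add, add_zero]
      exact (show φ (u + d) = m from hv).trans (show φ u = m from hu).symm
    rw [φ_eq_zero d (add_left_cancel h), add_zero]
  have hfin : (⋃ w ∈ {u : T → ℕ | φ u = m},
      (fun q : (T → ℕ) × (T → ℕ) => (φ q.1, φ q.2)) ''
        (Set.Iic w ×ˢ Set.Iic w)).Finite := by
    refine hfib.biUnion fun w _ => ?_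
    exact ((Set.finite_Iic w).prod (Set.finite_Iic w)).image _
  refine hfin.subset ?_
  rintro ⟨a, b⟩ hab
  obtain ⟨u, rfl⟩ := φ_surj a
  obtain ⟨v, rfl⟩ := φ_surj b
  refine Set.mem_biUnion (x := u + v) ?_ ⟨(u, v), ⟨?_, ?_⟩, rfl⟩
  · exact (φ_add u v).trans hab
  · exact Set.mem_Iic.2 le_self_add
  · exact Set.mem_Iic.2 le_add_self

/-- The finite set of pairs of elements with sum `m`. -/
noncomputable def antidiagonal (m : Γ) : Finset (Γ × Γ) := (finite_antidiagonal m).toFinset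

theorem mem_antidiagonal {m : Γ} {p : Γ × Γ} : p ∈ antidiagonal m ↔ p.1 + p.2 = m := by
  simp [antidiagonal]

end PointedAffine

/-- The power series ring `K[[Γ]]`: its elements are the formal sums `∑ m, f.coeff m · χ^m` over
`m : Γ`, that is, arbitrary families of coefficients in `K` indexed by `Γ`. -/
@[ext]
structure FormalToricRing (K Γ : Type*) where
  /-- the coefficient of `χ^m` -/
  coeff : Γ → K

namespace FormalToricRing

variable {K Γ : Type*}

section Add

variable [Field K]

instance : Zero (FormalToricRing K Γ) := ⟨⟨fun _ => 0⟩⟩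

instance : Add (FormalToricRing K Γ) := ⟨fun f g => ⟨fun m => f.coeff m + g.coeff m⟩⟩

instance : Neg (FormalToricRing K Γ) := ⟨fun f => ⟨fun m => -f.coeff m⟩⟩

theorem coeff_zero (m : Γ) : (0 : FormalToricRing K Γ).coeff m = 0 := rfl

theorem coeff_add (f g : FormalToricRing K Γ) (m : Γ) :
    (f + g).coeff m = f.coeff m + g.coeff m := rfl

theorem coeff_neg (f : FormalToricRing K Γ) (m : Γ) : (-f).coeff m = -f.coeff m := rfl

/-- Addition is coefficientwise. -/
instance : AddCommGroup (FormalToricRing K Γ) where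
  add_assoc f g h := by ext m; simp only [coeff_add, add_assoc]
  zero_add f := by ext m; simp only [coeff_add, coeff_zero, zero_add]
  add_zero f := by ext m; simp only [coeff_add, coeff_zero, add_zero]
  add_comm f g := by ext m; simp only [coeff_add, add_comm]
  neg_add_cancel f := by ext m; simp only [coeff_add, coeff_neg, coeff_zero, neg_add_cancel]
  nsmul := nsmulRec
  zsmul := zsmulRec

end Add

section Monomial

variable [Field K]

open Classical in
/-- The term `c · χ^m`. -/
noncomputable def term (m : Γ) (c : K) : FormalToricRing K Γ :=
  ⟨fun n => if n = m then c else 0⟩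

/-- The monomial `χ^m`. -/
noncomputable def monomial (m : Γ) : FormalToricRing K Γ := term m 1

/-- A series is a monomial if it is `c · χ^m` with `c ≠ 0`. -/
def IsMonomial (f : FormalToricRing K Γ) : Prop := ∃ (m : Γ) (c : K), c ≠ 0 ∧ f = term m c

noncomputable instance [AddCommMonoid Γ] : One (FormalToricRing K Γ) := ⟨monomial 0⟩

theorem coeff_one [AddCommMonoid Γ] [DecidableEq Γ] (m : Γ) :
    (1 : FormalToricRing K Γ).coeff m = if m = 0 then 1 else 0 := by
  by_cases h : m = 0
  · exact (if_pos h).trans (if_pos h).symm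
  · exact (if_neg h).trans (if_neg h).symm

end Monomial

section Ring

variable [Field K] [AddCommMonoid Γ] [PointedAffine Γ]

/-- Multiplication is the Cauchy product: the coefficient of `χ^m` in `f * g` is the (finite) sum
of the products `f.coeff a * g.coeff b` over all pairs with `a + b = m`. -/
noncomputable instance : Mul (FormalToricRing K Γ) :=
  ⟨fun f g => ⟨fun m => ∑ p ∈ PointedAffine.antidiagonal m, f.coeff p.1 * g.coeff p.2⟩⟩

theorem coeff_mul (f g : FormalToricRing K Γ) (m : Γ) :
    (f * g).coeff m = ∑ p ∈ PointedAffine.antidiagonal m, f.coeff p.1 * g.coeff p.2 := rfl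

protected theorem mul_comm (f g : FormalToricRing K Γ) : f * g = g * f := by
  ext m
  simp only [coeff_mul]
  refine Finset.sum_nbij' Prod.swap Prod.swap ?_ ?_ ?_ ?_ ?_ <;>
    simp [PointedAffine.mem_antidiagonal, add_comm, mul_comm]

protected theorem mul_assoc (f g h : FormalToricRing K Γ) : f * g * h = f * (g * h) := by
  ext m
  simp only [coeff_mul, Finset.sum_mul, Finset.mul_sum, Finset.sum_sigma']
  refine Finset.sum_nbij' (fun ⟨⟨_i, j⟩, ⟨k, l⟩⟩ ↦ ⟨(k, l + j), (l, j)⟩)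
    (fun ⟨⟨i, _j⟩, ⟨k, l⟩⟩ ↦ ⟨(i + k, l), (i, k)⟩) ?_ ?_ ?_ ?_ ?_
  · rintro ⟨⟨i, j⟩, ⟨k, l⟩⟩ hp
    simp only [Finset.mem_sigma, PointedAffine.mem_antidiagonal] at hp ⊢
    exact ⟨by rw [← hp.1, ← hp.2, add_assoc], trivial⟩
  · rintro ⟨⟨i, j⟩, ⟨k, l⟩⟩ hp
    simp only [Finset.mem_sigma, PointedAffine.mem_antidiagonal] at hp ⊢
    exact ⟨by rw [← hp.1, ← hp.2, add_assoc], trivial⟩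
  · rintro ⟨⟨i, j⟩, ⟨k, l⟩⟩ hp
    simp only [Finset.mem_sigma, PointedAffine.mem_antidiagonal] at hp ⊢
    obtain ⟨rfl, rfl⟩ := hp
    rfl
  · rintro ⟨⟨i, j⟩, ⟨k, l⟩⟩ hp
    simp only [Finset.mem_sigma, PointedAffine.mem_antidiagonal] at hp ⊢
    obtain ⟨rfl, rfl⟩ := hp
    rfl
  · rintro ⟨⟨i, j⟩, ⟨k, l⟩⟩ _
    exact mul_assoc _ _ _

protected theorem one_mul (f : FormalToricRing K Γ) : 1 * f = f := by
  classical
  ext m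
  rw [coeff_mul, Finset.sum_eq_single (0, m)]
  · simp [coeff_one]
  · rintro ⟨a, b⟩ hab hne
    rw [PointedAffine.mem_antidiagonal] at hab
    have ha : a ≠ 0 := by
      rintro rfl
      exact hne (by rw [← hab, zero_add])
    simp [coeff_one, ha]
  · intro h
    exact absurd (PointedAffine.mem_antidiagonal.2 (zero_add m)) h

protected theorem mul_add (f g h : FormalToricRing K Γ) : f * (g + h) = f * g + f * h := by
  ext m
  simp only [coeff_mul, coeff_add, mul_add, Finset.sum_add_distrib]

protected theorem mul_zero (f : FormalToricRing K Γ) : f * 0 = 0 := by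
  ext m
  simp only [coeff_mul, coeff_zero, mul_zero, Finset.sum_const_zero]

noncomputable instance : CommRing (FormalToricRing K Γ) where
  __ := (inferInstance : AddCommGroup (FormalToricRing K Γ))
  mul_comm := FormalToricRing.mul_comm
  mul_assoc := FormalToricRing.mul_assoc
  one_mul := FormalToricRing.one_mul
  mul_one f := by rw [FormalToricRing.mul_comm, FormalToricRing.one_mul]
  left_distrib := FormalToricRing.mul_add
  right_distrib f g h := by
    rw [FormalToricRing.mul_comm, FormalToricRing.mul_add, FormalToricRing.mul_comm h f,
      FormalToricRing.mul_comm h g]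
  zero_mul f := by rw [FormalToricRing.mul_comm, FormalToricRing.mul_zero]
  mul_zero := FormalToricRing.mul_zero

end Ring

end FormalToricRing

section Weights

variable (Γ : Type*) [AddCommMonoid Γ]

/-- The real vector space `M(Γ) ⊗ ℝ`, where `M(Γ)` is the group generated by the formal differences
of elements of `Γ`. -/
abbrev MReal : Type _ := ℝ ⊗[ℤ] Algebra.GrothendieckAddGroup Γ

/-- The real vector space `N(Γ) ⊗ ℝ`, realized as the dual of `M(Γ) ⊗ ℝ`. -/
abbrev NReal : Type _ := Module.Dual ℝ (MReal Γ)

variable {Γ}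

/-- The canonical map `Γ → M(Γ) ⊗ ℝ`. -/
noncomputable def toMReal (m : Γ) : MReal Γ := 1 ⊗ₜ[ℤ] Algebra.GrothendieckAddGroup.of m

/-- The pairing `⟨w, m⟩` of a weight vector with an exponent. -/
noncomputable def weight (w : NReal Γ) (m : Γ) : ℝ := w (toMReal m)

variable (Γ)

/-- The cone generated by `Γ` in `M(Γ) ⊗ ℝ`. -/
noncomputable def coneOf : PointedCone ℝ (MReal Γ) :=
  PointedCone.hull ℝ (Set.range (toMReal (Γ := Γ)))

/-- The cone `σ(Γ)` of all weight vectors that are nonnegative on the cone generated by `Γ`. -/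
def sigma : Set (NReal Γ) := {w | ∀ x ∈ coneOf Γ, 0 ≤ w x}

end Weights

/-- A local monomial ordering on `Γ`: a total order, compatible with addition, whose least element
is `0`. -/
structure LocalMonomialOrder (Γ : Type*) [AddCommMonoid Γ] where
  /-- the order relation -/
  le : Γ → Γ → Prop
  refl : ∀ m, le m m
  trans : ∀ m n p, le m n → le n p → le m p
  antisymm : ∀ m n, le m n → le n m → m = n
  total : ∀ m n, le m n ∨ le n m
  zero_le : ∀ m, le 0 m
  add_le_add : ∀ m m' n, le m m' → le (m + n) (m' + n)

namespace FormalToricRing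

variable {K Γ : Type*} [Field K] [AddCommMonoid Γ] [PointedAffine Γ]

open Classical in
/-- The initial monomial of `f`: the monomial `χ^m` whose exponent `m` is the least element of the
support of `f`. For `f = 0` it is `0`. -/
noncomputable def initialMonomial (r : LocalMonomialOrder Γ) (f : FormalToricRing K Γ) :
    FormalToricRing K Γ :=
  ⟨fun m => if f.coeff m ≠ 0 ∧ ∀ n, f.coeff n ≠ 0 → r.le m n then 1 else 0⟩

/-- The initial ideal of `I` with respect to a local monomial ordering. -/
noncomputable def initialIdeal (r : LocalMonomialOrder Γ) (I : Ideal (FormalToricRing K Γ)) :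
    Ideal (FormalToricRing K Γ) :=
  Ideal.span (initialMonomial r '' I)

open Classical in
/-- The `w`-initial form of `f`: the sum of those terms `f.coeff m · χ^m` of `f` for which `⟨w, m⟩` equals
the minimum of `⟨w, n⟩` over all `n` in the support of `f`. -/
noncomputable def initialForm (w : NReal Γ) (f : FormalToricRing K Γ) : FormalToricRing K Γ :=
  ⟨fun m => if ∀ n, f.coeff n ≠ 0 → weight w m ≤ weight w n then f.coeff m else 0⟩

/-- The `w`-initial ideal of `I`, generated by the `w`-initial forms of the elements of `I`. -/
noncomputable def weightInitialIdeal (w : NReal Γ) (I : Ideal (FormalToricRing K Γ)) :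
    Ideal (FormalToricRing K Γ) :=
  Ideal.span (initialForm w '' I)

/-- `B` is a standard basis of `I` with respect to `r`: a finite subset of `I` whose initial
monomials generate the initial ideal. -/
structure IsStandardBasis (r : LocalMonomialOrder Γ) (I : Ideal (FormalToricRing K Γ))
    (B : Set (FormalToricRing K Γ)) : Prop where
  finite : B.Finite
  subset : B ⊆ I
  span_eq : Ideal.span (initialMonomial r '' B) = initialIdeal r I

/-- `B` is a universal standard basis of `I`: a finite subset of `I` which is a standard basis with
respect to every local monomial ordering. -/
structure IsUniversalStandardBasis (I : Ideal (FormalToricRing K Γ))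
    (B : Set (FormalToricRing K Γ)) : Prop where
  finite : B.Finite
  subset : B ⊆ I
  isStandardBasis : ∀ r : LocalMonomialOrder Γ, IsStandardBasis r I B

/-- `B` is a tropical basis of `I`: a universal standard basis such that, for all `w` in `σ(Γ)`,
the `w`-initial ideal of `I` contains a monomial if and only if the `w`-initial form of some element
of `B` is a monomial. -/
structure IsTropicalBasis (I : Ideal (FormalToricRing K Γ))
    (B : Set (FormalToricRing K Γ)) : Prop extends IsUniversalStandardBasis I B where
  monomial_iff : ∀ w ∈ sigma Γ,
    (∃ g ∈ weightInitialIdeal w I, IsMonomial g) ↔ ∃ f ∈ B, IsMonomial (initialForm w f)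

end FormalToricRing

/-! ### Divisibility in a pointed affine semigroup -/

namespace PointedAffine

variable {Γ : Type*} [AddCommMonoid Γ] [PointedAffine Γ]

/-! Dickson's lemma makes divisibility on Γ a well-quasi-order. Hence every local ordering is a
well-order, the support of a series is generated by finitely many of its exponents, and division
with remainder can be carried out by recursion on exponents although supports are infinite.

Universal standard basis (`exists_finite_generatesLeading`). For one ordering, take the reduced
elements at generators of the set of leading exponents. They keep their leading exponents under
every ordering that satisfies finitely many inequalities, and an inclusion between the leading
exponents of I for two orderings is an equality (`leadingExponents_eq_of_subset`), so they are a
standard basis there too. Compactness of the space of orderings, proved with ultrafilter limits,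
leaves finitely many such sets; G is their union.

Monomials (`exists_finite_detecting`). The ideal in_w(I) contains a monomial iff some element of I
has a single exponent of least w-weight. Group the weights by the initial forms they give on G;
there are finitely many classes. Inside a class, neither the leading exponents of I for "weight
first, ties broken by r" nor the exponents m of monomial initial forms change. So if such an m
exists, the element reduced at m for one weight has initial exponent m for the whole class. Adding
one such element per class to G gives the tropical basis. -/

/-- Dickson's lemma for the divisibility relation of a pointed affine semigroup. -/
theorem wellQuasiOrdered_dvd : WellQuasiOrdered fun a b : Γ => ∃ c, b = a + c := by
  classical
  obtain ⟨S, hS⟩ := (AddMonoid.FG.fg_top : (⊤ : AddSubmonoid Γ).FG)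
  let φ : (S → ℕ) → Γ := fun u => ∑ t : S, u t • (t : Γ)
  have φ_surj (a : Γ) : ∃ u, φ u = a := by
    have ha : a ∈ AddSubmonoid.closure (S : Set Γ) := by rw [hS]; trivial
    induction ha using AddSubmonoid.closure_induction with
    | mem x hx =>
      refine ⟨Pi.single ⟨x, hx⟩ 1, ?_⟩
      simp only [φ]
      rw [Finset.sum_eq_single ⟨x, hx⟩]
      · simp
      · intro b _ hb
        simp [hb]
      · simp
    | zero => exact ⟨0, by simp [φ]⟩
    | add x y _ _ hx hy =>
      obtain ⟨u, rfl⟩ := hx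
      obtain ⟨v, rfl⟩ := hy
      exact ⟨u + v, by simp [φ, add_smul, Finset.sum_add_distrib]⟩
  intro f
  choose g hg using fun n => φ_surj (f n)
  obtain ⟨i, j, hij, hle⟩ := wellQuasiOrdered_le (α := S → ℕ) g
  obtain ⟨d, hd⟩ := exists_add_of_le hle
  refine ⟨i, j, hij, φ d, ?_⟩
  rw [← hg i, ← hg j, hd]
  simp [φ, add_smul, Finset.sum_add_distrib]

theorem eq_of_dvd_of_dvd {a b c d : Γ} (h : b = a + c) (h' : a = b + d) : a = b := by
  have h0 : b + (d + c) = b + 0 := by rw [← add_assoc, ← h', ← h, add_zero]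
  have hd : d = 0 := eq_zero_of_add_eq_zero _ _ (add_left_cancel h0)
  rw [h', hd, add_zero]

/-- Every subset of a pointed affine semigroup is generated, up to adding elements of the
semigroup, by a finite subset. -/
theorem exists_finset_generating (S : Set Γ) :
    ∃ A : Finset Γ, ↑A ⊆ S ∧ ∀ s ∈ S, ∃ a ∈ A, ∃ c, s = a + c := by
  -- The elements of S minimal for divisibility: an antichain, hence finite.
  let A : Set Γ := {s ∈ S | ∀ t ∈ S, ∀ c, s = t + c → t = s}
  have hA : A.Finite := by
    refine IsAntichain.finite_of_wellQuasiOrdered (r := fun a b : Γ => ∃ c, b = a + c) ?_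
      wellQuasiOrdered_dvd
    rintro a ha b hb hab ⟨c, hc⟩
    exact hab (hb.2 a ha.1 c hc)
  refine ⟨hA.toFinset, fun x hx => ?_, fun s hs => ?_⟩
  · exact ((Set.Finite.mem_toFinset _).1 hx).1
  · have : IsPreorder Γ (fun a b : Γ => ∃ c, b = a + c) :=
      { refl := fun a => ⟨0, (add_zero a).symm⟩
        trans := by
          rintro a b c ⟨d, rfl⟩ ⟨e, rfl⟩
          exact ⟨d + e, add_assoc _ _ _⟩ }
    have wf := (wellQuasiOrdered_dvd (Γ := Γ)).wellFounded
    obtain ⟨a, ⟨haS, c, hc⟩, hmin⟩ := wf.has_min {t | t ∈ S ∧ ∃ c, s = t + c}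
      ⟨s, hs, 0, (add_zero s).symm⟩
    refine ⟨a, hA.mem_toFinset.2 ⟨haS, fun t ht d hd => ?_⟩, c, hc⟩
    by_contra hne
    refine hmin t ⟨ht, d + c, by rw [hc, hd, add_assoc]⟩ ⟨⟨d, hd⟩, ?_⟩
    rintro ⟨e, he⟩
    exact hne (eq_of_dvd_of_dvd hd he)

end PointedAffine

/-! ### Local monomial orderings: compactness, well-foundedness, existence -/

namespace LocalMonomialOrder

variable {Γ : Type*} [AddCommMonoid Γ]

theorem le_add_right (r : LocalMonomialOrder Γ) (a c : Γ) : r.le a (a + c) := by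
  simpa [add_comm] using r.add_le_add 0 c a (r.zero_le c)

/-- The limit of local monomial orderings along an ultrafilter. -/
def ultralimit (F : Ultrafilter (LocalMonomialOrder Γ)) : LocalMonomialOrder Γ where
  le m n := {r : LocalMonomialOrder Γ | r.le m n} ∈ F
  refl m := Filter.mem_of_superset Filter.univ_mem fun r _ => r.refl m
  trans m n p h k :=
    Filter.mem_of_superset (Filter.inter_mem h k) fun r hr => r.trans _ _ _ hr.1 hr.2
  antisymm m n h k := by
    obtain ⟨r, hr⟩ := Ultrafilter.nonempty_of_mem (Filter.inter_mem h k)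
    exact r.antisymm _ _ hr.1 hr.2
  total m n := by
    rw [← Ultrafilter.union_mem_iff]
    exact Filter.mem_of_superset Filter.univ_mem fun r _ => r.total m n
  zero_le m := Filter.mem_of_superset Filter.univ_mem fun r _ => r.zero_le m
  add_le_add m m' n h := Filter.mem_of_superset h fun r hr => r.add_le_add _ _ _ hr

/-- The space of local monomial orderings is compact: if every ordering `r` is assigned finitely
many inequalities `C r` that it satisfies, then finitely many of the `C r` are enough for every
ordering to satisfy one of them. -/
theorem exists_finset_forall_exists_le (C : LocalMonomialOrder Γ → Finset (Γ × Γ))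
    (hC : ∀ r, ∀ p ∈ C r, r.le p.1 p.2) :
    ∃ S : Finset (LocalMonomialOrder Γ), ∀ r' : LocalMonomialOrder Γ,
      ∃ r ∈ S, ∀ p ∈ C r, r'.le p.1 p.2 := by
  classical
  by_contra hcon
  push Not at hcon
  let bad : LocalMonomialOrder Γ → Set (LocalMonomialOrder Γ) :=
    fun r => {r' | ∃ p ∈ C r, ¬ r'.le p.1 p.2}
  -- The negated claim says exactly that the sets `bad r` have the finite intersection property.
  obtain ⟨F, hF⟩ := Ultrafilter.exists_ultrafilter_of_finite_inter_nonempty (Set.range bad) (by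
    intro T hT
    obtain ⟨S, hS⟩ := Finset.subset_set_image_iff (s := Set.univ) (f := bad) |>.1
      (by simpa using hT)
    obtain ⟨r', hr'⟩ := hcon S
    refine ⟨r', ?_⟩
    rw [Set.mem_sInter]
    intro t ht
    rw [← hS.2] at ht
    obtain ⟨r, hr, rfl⟩ := by simpa using ht
    obtain ⟨p, hp, h⟩ := hr' r hr
    exact ⟨p, hp, h⟩)
  -- The limit ordering satisfies its own conditions; being finitely many, they hold simultaneously
  -- for almost all `r'`, against `bad (ultralimit F) ∈ F`.
  have h1 : ∀ᶠ r' in (F : Filter (LocalMonomialOrder Γ)), ∀ p ∈ C (ultralimit F), r'.le p.1 p.2 :=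
    (Filter.eventually_all_finset _).2 fun p hp => hC (ultralimit F) p hp
  have h2 : ∀ᶠ r' in (F : Filter (LocalMonomialOrder Γ)), ∃ p ∈ C (ultralimit F), ¬ r'.le p.1 p.2 :=
    hF ⟨_, rfl⟩
  obtain ⟨r', h1, p, hp, h2⟩ := (h1.and h2).exists
  exact h2 (h1 p hp)

variable [PointedAffine Γ]

/-- Since 0 is least, a divisor never exceeds its multiple, so the order inherits
well-quasi-ordering from divisibility. This supplies least exponents of infinite supports and the
recursion in the division. -/
theorem wellFounded (r : LocalMonomialOrder Γ) :
    WellFounded fun a b => r.le a b ∧ ¬ r.le b a := by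
  have : IsPreorder Γ r.le := { refl := r.refl, trans := r.trans }
  refine WellQuasiOrdered.wellFounded (r := r.le) fun f => ?_
  obtain ⟨i, j, hij, c, hc⟩ := PointedAffine.wellQuasiOrdered_dvd f
  exact ⟨i, j, hij, hc ▸ r.le_add_right _ _⟩

theorem exists_least (r : LocalMonomialOrder Γ) {S : Set Γ} (hS : S.Nonempty) :
    ∃ m ∈ S, ∀ n ∈ S, r.le m n := by
  obtain ⟨m, hm, hmin⟩ := r.wellFounded.has_min S hS
  refine ⟨m, hm, fun n hn => ?_⟩
  by_contra h
  exact hmin n hn ⟨(r.total m n).resolve_left h, h⟩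

/-- Comparison by weight first, with ties broken by a local monomial ordering. -/
def refine (r : LocalMonomialOrder Γ) (v : Γ →+ ℝ) (hv : ∀ m, 0 ≤ v m) :
    LocalMonomialOrder Γ where
  le m n := v m < v n ∨ v m = v n ∧ r.le m n
  refl m := Or.inr ⟨rfl, r.refl m⟩
  trans := by
    rintro m n p (h | ⟨h, h'⟩) (k | ⟨k, k'⟩)
    · exact Or.inl (h.trans k)
    · exact Or.inl (k ▸ h)
    · exact Or.inl (h ▸ k)
    · exact Or.inr ⟨h.trans k, r.trans _ _ _ h' k'⟩
  antisymm := by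
    rintro m n (h | ⟨h, h'⟩) (k | ⟨k, k'⟩)
    · exact absurd h k.asymm
    · exact absurd k.symm h.ne
    · exact absurd h.symm k.ne
    · exact r.antisymm _ _ h' k'
  total m n := by
    rcases lt_trichotomy (v m) (v n) with h | h | h
    · exact Or.inl (Or.inl h)
    · exact (r.total m n).imp (fun k => Or.inr ⟨h, k⟩) (fun k => Or.inr ⟨h.symm, k⟩)
    · exact Or.inr (Or.inl h)
  zero_le m := by
    rcases (hv m).lt_or_eq with h | h
    · exact Or.inl (by simpa using h)
    · exact Or.inr ⟨by simpa using h, r.zero_le m⟩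
  add_le_add m m' n := by
    rintro (h | ⟨h, h'⟩)
    · exact Or.inl (by simpa using h)
    · exact Or.inr ⟨by simpa using h, r.add_le_add _ _ _ h'⟩

section Existence

open Algebra

/-- A submonoid without nontrivial units in a torsion-free abelian group extends to a total one. -/
theorem exists_total_submonoid {M : Type*} [AddCommGroup M] [IsAddTorsionFree M]
    (P : AddSubmonoid M) (hP : ∀ x ∈ P, -x ∈ P → x = 0) :
    ∃ Q : AddSubmonoid M, P ≤ Q ∧ (∀ x ∈ Q, -x ∈ Q → x = 0) ∧ ∀ x, x ∈ Q ∨ -x ∈ Q := by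
  obtain ⟨Q, hPQ, hQ, hmax⟩ := zorn_le_nonempty₀ {Q : AddSubmonoid M | ∀ x ∈ Q, -x ∈ Q → x = 0}
    (by
      intro c hc hchain y hy
      have hdir : DirectedOn (· ≤ ·) c := hchain.directedOn
      refine ⟨sSup c, fun x hx hx' => ?_, fun z hz => le_sSup hz⟩
      rw [AddSubmonoid.mem_sSup_of_directedOn ⟨y, hy⟩ hdir] at hx hx'
      obtain ⟨s, hs, hxs⟩ := hx
      obtain ⟨t, ht, hxt⟩ := hx'
      obtain ⟨u, hu, hsu, htu⟩ := hdir s hs t ht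
      exact hc hu x (hsu hxs) (htu hxt)) P hP
  refine ⟨Q, hPQ, hQ, fun x => ?_⟩
  -- By maximality, adjoining a missing `x` creates a nontrivial unit, and this forces a negative
  -- multiple of `x` into `Q`. Applied to both `x` and `-x`, it puts a common multiple and its
  -- negative in `Q`, so torsion-freeness gives `x = 0`.
  have key (x : M) (hx : x ∉ Q) : ∃ k : ℕ, k ≠ 0 ∧ -(k • x) ∈ Q := by
    by_contra hcon
    push Not at hcon
    refine hx (hmax (y := Q ⊔ AddSubmonoid.multiples x) ?_ le_sup_left
      (AddSubmonoid.mem_sup_right (AddSubmonoid.mem_multiples x)))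
    intro y hy hy'
    obtain ⟨p, hp, _, ⟨n, rfl⟩, rfl⟩ := AddSubmonoid.mem_sup.1 hy
    obtain ⟨p', hp', _, ⟨n', rfl⟩, h⟩ := AddSubmonoid.mem_sup.1 hy'
    simp only at h ⊢
    have hs : -((n + n') • x) = p + p' := by
      rw [add_smul]
      have : p' = -(p + n • x) - n' • x := by rw [← h]; abel
      rw [this]; abel
    have hn : n + n' = 0 := by
      by_contra h0
      exact hcon _ h0 (hs ▸ Q.add_mem hp hp')
    obtain ⟨rfl, rfl⟩ : n = 0 ∧ n' = 0 := by omega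
    have hpp : -p = p' := by simpa using h.symm
    simpa using hQ p hp (hpp ▸ hp')
  by_contra hcon
  push Not at hcon
  obtain ⟨k, hk, h1⟩ := key x hcon.1
  obtain ⟨l, hl, h2⟩ := key (-x) hcon.2
  have h1' : -((l * k) • x) ∈ Q := by
    rw [mul_smul, ← smul_neg]; exact Q.nsmul_mem h1 l
  have h2' : (l * k) • x ∈ Q := by
    rw [mul_comm, mul_smul]
    exact Q.nsmul_mem (by simpa using h2) k
  have h3 := hQ _ h2' h1'
  have : x = 0 := (smul_eq_zero.1 h3).resolve_left (by positivity)
  exact hcon.1 (this ▸ Q.zero_mem)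

/-- Pointedness says that the image of Γ in its group has no nontrivial units, so it extends to the
positive cone of a total order. Some ordering is needed later to break ties between equal weights.
-/
instance : Nonempty (LocalMonomialOrder Γ) := by
  let of : Γ →+ GrothendieckAddGroup Γ := GrothendieckAddGroup.of
  have hinj : Function.Injective of := GrothendieckAddGroup.of_injective
  obtain ⟨Q, hPQ, hQ, htot⟩ := exists_total_submonoid (AddMonoidHom.mrange of) (by
    rintro _ ⟨a, rfl⟩ ⟨b, hb⟩
    have h : of (a + b) = of 0 := by rw [map_add, hb, map_zero, add_neg_cancel]
    rw [PointedAffine.eq_zero_of_add_eq_zero a b (hinj h), map_zero])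
  exact ⟨{
    le := fun m n => of n - of m ∈ Q
    refl := fun m => by simp
    trans := fun m n p h k => by simpa using Q.add_mem k h
    antisymm := fun m n h k => hinj (sub_eq_zero.1 (hQ _ k (by simpa using h)))
    total := fun m n => by simpa using htot (of n - of m)
    zero_le := fun m => by simpa using hPQ ⟨m, rfl⟩
    add_le_add := fun m m' n h => by simpa using h }⟩

end Existence

end LocalMonomialOrder

/-! ### Leading exponents of series -/

namespace FormalToricRing

variable {K Γ : Type*} [Field K]

theorem coeff_sub (f g : FormalToricRing K Γ) (m : Γ) :
    (f - g).coeff m = f.coeff m - g.coeff m := by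
  rw [sub_eq_add_neg, coeff_add, coeff_neg, ← sub_eq_add_neg]

theorem coeff_sum {ι : Type*} (s : Finset ι) (f : ι → FormalToricRing K Γ) (m : Γ) :
    (∑ i ∈ s, f i).coeff m = ∑ i ∈ s, (f i).coeff m :=
  map_sum (⟨⟨fun f => f.coeff m, rfl⟩, fun _ _ => rfl⟩ : FormalToricRing K Γ →+ K) f s

theorem coeff_term_same (m : Γ) (c : K) : (term m c).coeff m = c := if_pos rfl

theorem coeff_term_of_ne {m n : Γ} (h : n ≠ m) (c : K) : (term m c).coeff n = 0 := if_neg h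

theorem exists_coeff_ne_zero {f : FormalToricRing K Γ} (hf : f ≠ 0) : ∃ m, f.coeff m ≠ 0 := by
  by_contra! h
  exact hf (FormalToricRing.ext (funext h))

variable [AddCommMonoid Γ]

/-- `m` is the least exponent of `f` with respect to `r`. -/
def IsLeading (r : LocalMonomialOrder Γ) (f : FormalToricRing K Γ) (m : Γ) : Prop :=
  f.coeff m ≠ 0 ∧ ∀ n, f.coeff n ≠ 0 → r.le m n

theorem IsLeading.unique {r : LocalMonomialOrder Γ} {f : FormalToricRing K Γ} {m n : Γ}
    (hm : IsLeading r f m) (hn : IsLeading r f n) : m = n :=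
  r.antisymm _ _ (hm.2 _ hn.1) (hn.2 _ hm.1)

theorem IsLeading.initialMonomial_eq {r : LocalMonomialOrder Γ} {f : FormalToricRing K Γ} {m : Γ}
    (hm : IsLeading r f m) : initialMonomial r f = monomial m := by
  classical
  ext n
  by_cases h : n = m
  · subst h
    exact (if_pos hm).trans (coeff_term_same _ _).symm
  · refine (if_neg fun hn => h (IsLeading.unique (r := r) (f := f) hn hm)).trans
      (coeff_term_of_ne h _).symm

theorem initialMonomial_zero (r : LocalMonomialOrder Γ) :
    initialMonomial r (0 : FormalToricRing K Γ) = 0 := by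
  classical
  ext n
  exact if_neg fun h => h.1 rfl

variable [PointedAffine Γ]

theorem exists_coeff_mul_ne_zero {f g : FormalToricRing K Γ} {m : Γ} (h : (f * g).coeff m ≠ 0) :
    ∃ a b, a + b = m ∧ f.coeff a ≠ 0 ∧ g.coeff b ≠ 0 := by
  rw [coeff_mul] at h
  obtain ⟨p, hp, hne⟩ := Finset.exists_ne_zero_of_sum_ne_zero h
  exact ⟨p.1, p.2, PointedAffine.mem_antidiagonal.1 hp, left_ne_zero_of_mul hne,
    right_ne_zero_of_mul hne⟩

theorem coeff_term_mul_add (a n : Γ) (c : K) (f : FormalToricRing K Γ) :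
    (term a c * f).coeff (a + n) = c * f.coeff n := by
  rw [coeff_mul, Finset.sum_eq_single (a, n)]
  · rw [coeff_term_same]
  · rintro ⟨x, y⟩ hxy hne
    rw [PointedAffine.mem_antidiagonal] at hxy
    have hx : x ≠ a := by
      rintro rfl
      obtain rfl : y = n := add_left_cancel hxy
      exact hne rfl
    rw [coeff_term_of_ne hx, zero_mul]
  · intro h
    exact absurd (PointedAffine.mem_antidiagonal.2 rfl) h

theorem exists_isLeading (r : LocalMonomialOrder Γ) {f : FormalToricRing K Γ} (hf : f ≠ 0) :
    ∃ m, IsLeading r f m :=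
  r.exists_least (S := {m | f.coeff m ≠ 0}) (exists_coeff_ne_zero hf)

theorem IsLeading.term_mul {r : LocalMonomialOrder Γ} {f : FormalToricRing K Γ} {m : Γ}
    (hm : IsLeading r f m) (a : Γ) : IsLeading r (monomial a * f) (m + a) := by
  refine ⟨?_, fun n hn => ?_⟩
  · rw [add_comm, monomial, coeff_term_mul_add, one_mul]
    exact hm.1
  · obtain ⟨x, y, rfl, hx, hy⟩ := exists_coeff_mul_ne_zero hn
    have : x = a := by
      by_contra h
      exact hx (coeff_term_of_ne h _)
    rw [this, add_comm a]
    exact r.add_le_add _ _ _ (hm.2 _ hy)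

theorem monomial_mul_monomial (a b : Γ) :
    (monomial a * monomial b : FormalToricRing K Γ) = monomial (a + b) := by
  ext n
  by_cases h : n = a + b
  · rw [h, monomial, coeff_term_mul_add, monomial, monomial, coeff_term_same, coeff_term_same,
      one_mul]
  · rw [monomial, monomial, monomial, coeff_term_of_ne h]
    by_contra hne
    obtain ⟨x, y, hxy, hx, hy⟩ := exists_coeff_mul_ne_zero hne
    have hx' : x = a := by
      by_contra h
      exact hx (coeff_term_of_ne h _)
    have hy' : y = b := by
      by_contra h
      exact hy (coeff_term_of_ne h _)
    exact h (by rw [← hxy, hx', hy'])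

/-! ### Division with remainder -/

/-- Division with remainder by a finite family of series indexed by their leading exponents. -/
theorem exists_division (r : LocalMonomialOrder Γ) (A : Finset Γ) (f : Γ → FormalToricRing K Γ)
    (hf : ∀ a ∈ A, IsLeading r (f a) a) (h : FormalToricRing K Γ) :
    ∃ (k : Γ → FormalToricRing K Γ) (ρ : FormalToricRing K Γ),
      h = ∑ a ∈ A, k a * f a + ρ ∧
      (∀ a ∈ A, ∀ c, ρ.coeff (a + c) = 0) ∧
      ∀ m, (∀ n, h.coeff n ≠ 0 → r.le m n) →
        ∀ a ∈ A, ∀ n, (k a).coeff n ≠ 0 → r.le m (a + n) := by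
  classical
  let D : Γ → Prop := fun n => ∃ a ∈ A, ∃ c, n = a + c
  -- One divisor is fixed for each divisible exponent. The value 0 elsewhere is never used, because
  -- `P` requires `D n`.
  let p : Γ → Γ := fun n => if hn : D n then hn.choose else 0
  have hp (n : Γ) (hn : D n) : p n ∈ A ∧ ∃ c, n = p n + c := by
    simp only [p, dif_pos hn]
    exact hn.choose_spec
  let P : Γ → Γ → Prop := fun n a => D n ∧ p n = a
  -- `q n` is the coefficient still to be cancelled at `n` once all strictly smaller exponents have
  -- been treated. It goes into the quotient of `p n` if `n` is divisible, and into the remainder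
  -- otherwise.
  let F : (n : Γ) → ((y : Γ) → (r.le y n ∧ ¬ r.le n y) → K) → K := fun n q =>
    h.coeff n - ∑ a ∈ A, ∑ y ∈ PointedAffine.antidiagonal n,
      if hlt : r.le (a + y.1) n ∧ ¬ r.le n (a + y.1) then
        (if P (a + y.1) a then q (a + y.1) hlt / (f a).coeff a else 0) * (f a).coeff y.2 else 0
  let q : Γ → K := r.wellFounded.fix F
  have hq (n : Γ) : q n = h.coeff n - ∑ a ∈ A, ∑ y ∈ PointedAffine.antidiagonal n,
      if r.le (a + y.1) n ∧ ¬ r.le n (a + y.1) then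
        (if P (a + y.1) a then q (a + y.1) / (f a).coeff a else 0) * (f a).coeff y.2 else 0 := by
    refine (r.wellFounded.fix_eq F n).trans ?_
    simp only [F, dite_eq_ite]
    rfl
  let k : Γ → FormalToricRing K Γ := fun a =>
    ⟨fun n => if P (a + n) a then q (a + n) / (f a).coeff a else 0⟩
  let ρ : FormalToricRing K Γ := ⟨fun n => if D n then 0 else q n⟩
  have hterm (n a : Γ) (ha : a ∈ A) : (k a * f a).coeff n =
      (∑ y ∈ PointedAffine.antidiagonal n,
        if r.le (a + y.1) n ∧ ¬ r.le n (a + y.1) then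
          (if P (a + y.1) a then q (a + y.1) / (f a).coeff a else 0) * (f a).coeff y.2 else 0) +
      if P n a then q n else 0 := by
    have hsplit : (if P n a then q n else 0) = ∑ y ∈ PointedAffine.antidiagonal n,
        if a + y.1 = n then (k a).coeff y.1 * (f a).coeff y.2 else 0 := by
      by_cases hn : ∃ c, n = a + c
      · obtain ⟨c, rfl⟩ := hn
        rw [Finset.sum_eq_single (c, a), if_pos rfl]
        · simp only [k]
          split_ifs
          · rw [div_mul_cancel₀ _ (hf a ha).1]
          · rw [zero_mul]
        · rintro ⟨x, y⟩ hxy hne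
          refine if_neg fun hx => hne ?_
          obtain rfl : x = c := add_left_cancel hx
          have := PointedAffine.mem_antidiagonal.1 hxy
          simp only [add_comm a x] at this
          rw [add_left_cancel this]
        · intro hc
          exact absurd (PointedAffine.mem_antidiagonal.2 (add_comm c a)) hc
      · rw [if_neg, Finset.sum_eq_zero]
        · intro y _
          exact if_neg fun hy => hn ⟨_, hy.symm⟩
        · rintro ⟨h1, h2⟩
          obtain ⟨_, c, hc⟩ := hp n h1
          exact hn ⟨c, h2 ▸ hc⟩
    rw [coeff_mul, hsplit, ← Finset.sum_add_distrib]
    refine Finset.sum_congr rfl fun y hy => ?_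
    rw [PointedAffine.mem_antidiagonal] at hy
    -- As `a` is least in `f a`, a nonzero product at `n` has `a + y.1 ≤ n`: the strict case is the
    -- recursive sum, equality is the newly chosen quotient term.
    by_cases hy0 : (f a).coeff y.2 = 0
    · simp [hy0]
    · have hle : r.le (a + y.1) n := by
        rw [← hy, add_comm y.1]
        exact r.add_le_add _ _ _ ((hf a ha).2 _ hy0)
      by_cases heq : a + y.1 = n
      · rw [if_pos heq, if_neg fun hh => hh.2 (heq ▸ r.refl _), zero_add]
      · rw [if_neg heq, if_pos ⟨hle, fun hh => heq (r.antisymm _ _ hle hh)⟩, add_zero]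
  refine ⟨k, ρ, ?_, ?_, ?_⟩
  · ext n
    rw [coeff_add, coeff_sum, Finset.sum_congr rfl fun a ha => hterm n a ha,
      Finset.sum_add_distrib, add_assoc]
    have hone : (∑ a ∈ A, if P n a then q n else 0) + ρ.coeff n = q n := by
      by_cases hn : D n
      · rw [Finset.sum_eq_single (p n)]
        · simp only [ρ, if_pos hn, add_zero]
          exact if_pos ⟨hn, rfl⟩
        · exact fun b _ hb => if_neg fun hh => hb hh.2.symm
        · exact fun hh => absurd (hp n hn).1 hh
      · rw [Finset.sum_eq_zero fun a _ => if_neg fun hh => hn hh.1]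
        simp only [ρ, if_neg hn, zero_add]
    rw [hone]
    exact (eq_sub_iff_add_eq'.1 (hq n)).symm
  · exact fun a ha c => if_pos ⟨a, ha, c, rfl⟩
  · intro m hm
    have key : ∀ n, q n ≠ 0 → r.le m n := by
      intro n
      induction n using r.wellFounded.induction with
      | _ n ih =>
        intro hn
        by_contra hmn
        apply hn
        rw [hq n, Finset.sum_eq_zero, sub_zero]
        · by_contra hh
          exact hmn (hm n hh)
        · intro a _
          refine Finset.sum_eq_zero fun y _ => ?_
          split_ifs with h1 h2
          · have : q (a + y.1) = 0 := by
              by_contra hh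
              exact hmn (r.trans _ _ _ (ih _ h1 hh) h1.1)
            rw [this, zero_div, zero_mul]
          · rw [zero_mul]
          · rfl
    intro a _ n hn
    apply key
    intro h0
    apply hn
    simp only [k, h0, zero_div, ite_self]

/-! ### Normal forms and reduced elements -/

/-- The leading exponents of the elements of an ideal. -/
def leadingExponents (r : LocalMonomialOrder Γ) (I : Ideal (FormalToricRing K Γ)) : Set Γ :=
  {m | ∃ f ∈ I, IsLeading r f m}

theorem add_mem_leadingExponents {r : LocalMonomialOrder Γ} {I : Ideal (FormalToricRing K Γ)}
    {m : Γ} (hm : m ∈ leadingExponents r I) (c : Γ) : m + c ∈ leadingExponents r I := by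
  obtain ⟨f, hf, hfm⟩ := hm
  exact ⟨_, I.mul_mem_left _ hf, hfm.term_mul c⟩

/-- The leading exponent of a nonzero element would contradict the vanishing. This is what kills
remainders that lie in the ideal. -/
theorem eq_zero_of_coeff_leadingExponents_eq_zero {r : LocalMonomialOrder Γ}
    {I : Ideal (FormalToricRing K Γ)} {f : FormalToricRing K Γ} (hf : f ∈ I)
    (h : ∀ m ∈ leadingExponents r I, f.coeff m = 0) : f = 0 := by
  by_contra hne
  obtain ⟨m, hm⟩ := exists_isLeading r hne
  exact hm.1 (h m ⟨f, hf, hm⟩)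

/-- Every series has a normal form modulo an ideal. -/
theorem exists_normalForm (r : LocalMonomialOrder Γ) (I : Ideal (FormalToricRing K Γ))
    (h : FormalToricRing K Γ) :
    ∃ ρ, h - ρ ∈ I ∧ ∀ m ∈ leadingExponents r I, ρ.coeff m = 0 := by
  obtain ⟨A, hA, hgen⟩ := PointedAffine.exists_finset_generating (leadingExponents r I)
  choose! f hfI hf using hA
  obtain ⟨k, ρ, hk, hρ, -⟩ := exists_division r A f hf h
  refine ⟨ρ, ?_, fun m hm => ?_⟩
  · rw [hk, add_sub_cancel_right]
    exact I.sum_mem fun a ha => I.mul_mem_left _ (hfI ha)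
  · obtain ⟨a, ha, c, rfl⟩ := hgen m hm
    exact hρ a ha c

/-- For a leading exponent `m` there is an element of the ideal in which `χ^m` is the only term
whose exponent is a leading exponent of the ideal. -/
theorem exists_reduced {r : LocalMonomialOrder Γ} {I : Ideal (FormalToricRing K Γ)} {m : Γ}
    (hm : m ∈ leadingExponents r I) :
    ∃ f ∈ I, f.coeff m = 1 ∧ ∀ n ∈ leadingExponents r I, n ≠ m → f.coeff n = 0 := by
  obtain ⟨ρ, hρI, hρ⟩ := exists_normalForm r I (monomial m)
  refine ⟨_, hρI, ?_, fun n hn hne => ?_⟩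
  · rw [coeff_sub, hρ m hm, sub_zero, monomial, coeff_term_same]
  · rw [coeff_sub, hρ n hn, sub_zero, monomial, coeff_term_of_ne hne]

/-- Take the element reduced at `m` for `r'`. Its `r`-leading exponent lies in the smaller set,
hence in the larger one, where only `m` has a nonzero coefficient; so it is `m`. -/
theorem leadingExponents_eq_of_subset {r r' : LocalMonomialOrder Γ}
    {I : Ideal (FormalToricRing K Γ)} (h : leadingExponents r I ⊆ leadingExponents r' I) :
    leadingExponents r I = leadingExponents r' I := by
  refine h.antisymm fun m hm => ?_
  obtain ⟨f, hfI, hfm, hf⟩ := exists_reduced hm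
  have hne : f ≠ 0 := by
    rintro rfl
    exact zero_ne_one hfm
  obtain ⟨n, hn⟩ := exists_isLeading r hne
  have hnr : n ∈ leadingExponents r I := ⟨f, hfI, hn⟩
  have : n = m := by
    by_contra hnm
    exact hn.1 (hf n (h hnr) hnm)
  exact this ▸ hnr

/-! ### Universal standard bases -/

/-- The leading exponents of `G` generate those of `I`. -/
def GeneratesLeading (r : LocalMonomialOrder Γ) (I : Ideal (FormalToricRing K Γ))
    (G : Set (FormalToricRing K Γ)) : Prop :=
  ∀ m ∈ leadingExponents r I, ∃ g ∈ G, ∃ a c, IsLeading r g a ∧ m = a + c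

theorem GeneratesLeading.mono {r : LocalMonomialOrder Γ} {I : Ideal (FormalToricRing K Γ)}
    {G H : Set (FormalToricRing K Γ)} (hG : GeneratesLeading r I G) (h : G ⊆ H) :
    GeneratesLeading r I H := fun m hm => by
  obtain ⟨g, hg, hh⟩ := hG m hm
  exact ⟨g, h hg, hh⟩

theorem GeneratesLeading.isStandardBasis {r : LocalMonomialOrder Γ}
    {I : Ideal (FormalToricRing K Γ)} {G : Set (FormalToricRing K Γ)}
    (hG : GeneratesLeading r I G) (hfin : G.Finite) (hsub : G ⊆ I) : IsStandardBasis r I G := by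
  refine ⟨hfin, hsub, le_antisymm (Ideal.span_mono (Set.image_mono hsub)) (Ideal.span_le.2 ?_)⟩
  rintro _ ⟨f, hf, rfl⟩
  by_cases h0 : f = 0
  · rw [h0, initialMonomial_zero]
    exact Ideal.zero_mem _
  · obtain ⟨m, hm⟩ := exists_isLeading r h0
    obtain ⟨g, hg, a, c, hga, rfl⟩ := hG m ⟨f, hf, hm⟩
    rw [hm.initialMonomial_eq, add_comm, ← monomial_mul_monomial, ← hga.initialMonomial_eq]
    exact Ideal.mul_mem_left _ _ (Ideal.subset_span ⟨g, hg, rfl⟩)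

/-- Standard representations with respect to a finite set whose leading exponents generate. -/
theorem GeneratesLeading.exists_representation {r : LocalMonomialOrder Γ}
    {I : Ideal (FormalToricRing K Γ)} {G : Set (FormalToricRing K Γ)}
    (hG : GeneratesLeading r I G) (hfin : G.Finite) (hsub : G ⊆ I) {h : FormalToricRing K Γ}
    (hI : h ∈ I) :
    ∃ (A : Finset Γ) (f k : Γ → FormalToricRing K Γ),
      (∀ a ∈ A, f a ∈ G ∧ IsLeading r (f a) a) ∧ h = ∑ a ∈ A, k a * f a ∧
      ∀ m, (∀ n, h.coeff n ≠ 0 → r.le m n) →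
        ∀ a ∈ A, ∀ n, (k a).coeff n ≠ 0 → r.le m (a + n) := by
  classical
  have hA : {a | ∃ g ∈ G, IsLeading r g a}.Finite := by
    have : {a | ∃ g ∈ G, IsLeading r g a} = ⋃ g ∈ G, {a | IsLeading r g a} := by
      ext; simp
    rw [this]
    exact hfin.biUnion fun g _ => Set.Subsingleton.finite fun a ha b hb => ha.unique hb
  have hex : ∀ a ∈ hA.toFinset, ∃ g ∈ G, IsLeading r g a := fun a ha => hA.mem_toFinset.1 ha
  choose! f hfG hf using hex
  obtain ⟨k, ρ, hk, hρ, hle⟩ := exists_division r hA.toFinset f hf h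
  refine ⟨hA.toFinset, f, k, fun a ha => ⟨hfG a ha, hf a ha⟩, ?_, hle⟩
  have hsum : ∑ a ∈ hA.toFinset, k a * f a ∈ I :=
    I.sum_mem fun a ha => I.mul_mem_left _ (hsub (hfG a ha))
  have hρI : ρ ∈ I := by
    have : ρ = h - ∑ a ∈ hA.toFinset, k a * f a := by rw [hk, add_sub_cancel_left]
    exact this ▸ I.sub_mem hI hsum
  rw [hk, eq_zero_of_coeff_leadingExponents_eq_zero (r := r) hρI, add_zero]
  intro m hm
  obtain ⟨g, hg, a, c, hga, rfl⟩ := hG m hm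
  exact hρ a (hA.mem_toFinset.2 ⟨g, hg, hga⟩) c

/-- The inequalities compare each generator `a` with finitely many generators of the support of its
reduced element. All other exponents are multiples of these, so any ordering satisfying the
inequalities keeps `a` leading. -/
theorem exists_finset_conditions (r : LocalMonomialOrder Γ) (I : Ideal (FormalToricRing K Γ)) :
    ∃ (C : Finset (Γ × Γ)) (G : Set (FormalToricRing K Γ)), G.Finite ∧ G ⊆ I ∧
      (∀ p ∈ C, r.le p.1 p.2) ∧
      ∀ r' : LocalMonomialOrder Γ, (∀ p ∈ C, r'.le p.1 p.2) → GeneratesLeading r' I G := by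
  classical
  obtain ⟨A, hA, hgen⟩ := PointedAffine.exists_finset_generating (leadingExponents r I)
  have hred := fun a (ha : a ∈ A) => exists_reduced (hA ha)
  choose! f hfI hfa hf using hred
  choose B hB hBgen using fun a => PointedAffine.exists_finset_generating {m | (f a).coeff m ≠ 0}
  refine ⟨A.biUnion fun a => (B a).image fun b => (a, b), f '' A, A.finite_toSet.image f, ?_, ?_,
    ?_⟩
  · rintro _ ⟨a, ha, rfl⟩
    exact hfI a ha
  · intro p hp
    simp only [Finset.mem_biUnion, Finset.mem_image] at hp
    obtain ⟨a, ha, b, hb, rfl⟩ := hp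
    have hne : f a ≠ 0 := by
      intro h
      exact zero_ne_one (h ▸ hfa a ha)
    obtain ⟨n, hn⟩ := exists_isLeading r hne
    have : n = a := by
      by_contra hna
      exact hn.1 (hf a ha n ⟨_, hfI a ha, hn⟩ hna)
    exact this ▸ hn.2 b (hB a hb)
  · intro r' hr'
    have hlead : ∀ a ∈ A, IsLeading r' (f a) a := by
      refine fun a ha => ⟨by rw [hfa a ha]; exact one_ne_zero, fun n hn => ?_⟩
      obtain ⟨b, hb, c, rfl⟩ := hBgen a n hn
      refine r'.trans _ _ _ (hr' (a, b) ?_) (r'.le_add_right b c)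
      exact Finset.mem_biUnion.2 ⟨a, ha, Finset.mem_image.2 ⟨b, hb, rfl⟩⟩
    have heq : leadingExponents r I = leadingExponents r' I := by
      refine leadingExponents_eq_of_subset fun m hm => ?_
      obtain ⟨a, ha, c, rfl⟩ := hgen m hm
      exact add_mem_leadingExponents ⟨f a, hfI a ha, hlead a ha⟩ c
    intro m hm
    obtain ⟨a, ha, c, rfl⟩ := hgen m (heq ▸ hm)
    exact ⟨f a, ⟨a, ha, rfl⟩, a, c, hlead a ha, rfl⟩

/-- Every ideal contains a finite set that is a standard basis for all local orderings. -/
theorem exists_finite_generatesLeading (I : Ideal (FormalToricRing K Γ)) :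
    ∃ G : Set (FormalToricRing K Γ), G.Finite ∧ G ⊆ I ∧ ∀ r, GeneratesLeading r I G := by
  choose C G hfin hsub hC hG using fun r => exists_finset_conditions r I
  obtain ⟨S, hS⟩ := LocalMonomialOrder.exists_finset_forall_exists_le C hC
  refine ⟨⋃ r ∈ S, G r, S.finite_toSet.biUnion fun r _ => hfin r,
    Set.iUnion₂_subset fun r _ => hsub r, fun r' => ?_⟩
  obtain ⟨r, hr, h⟩ := hS r'
  exact (hG r r' h).mono (Set.subset_biUnion_of_mem (u := G) hr)

end FormalToricRing

/-! ### Weights and initial forms -/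

section Weights

variable {Γ : Type*} [AddCommMonoid Γ]

/-- The pairing with a weight vector as an additive map on exponents. -/
noncomputable def weightHom (w : NReal Γ) : Γ →+ ℝ where
  toFun := weight w
  map_zero' := by simp [weight, toMReal]
  map_add' m n := by simp [weight, toMReal, TensorProduct.tmul_add]

theorem weightHom_nonneg {w : NReal Γ} (hw : w ∈ sigma Γ) (m : Γ) : 0 ≤ weightHom w m :=
  hw _ (PointedCone.subset_hull ⟨m, rfl⟩)

end Weights

namespace FormalToricRing

variable {K Γ : Type*} [Field K] [AddCommMonoid Γ]

theorem coeff_initialForm_of_le {w : NReal Γ} {f : FormalToricRing K Γ} {m : Γ}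
    (h : ∀ n, f.coeff n ≠ 0 → weightHom w m ≤ weightHom w n) :
    (initialForm w f).coeff m = f.coeff m := by
  classical
  exact if_pos h

theorem weight_le_of_coeff_initialForm_ne_zero {w : NReal Γ} {f : FormalToricRing K Γ} {m : Γ}
    (h : (initialForm w f).coeff m ≠ 0) :
    f.coeff m ≠ 0 ∧ ∀ n, f.coeff n ≠ 0 → weightHom w m ≤ weightHom w n := by
  classical
  have h' : (if ∀ n, f.coeff n ≠ 0 → weight w m ≤ weight w n then f.coeff m else 0) ≠ 0 := h
  by_cases hc : ∀ n, f.coeff n ≠ 0 → weight w m ≤ weight w n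
  · exact ⟨by rwa [if_pos hc] at h', hc⟩
  · exact absurd (if_neg hc) h'

/-- The exponents of minimal weight in `f` are the same for weights with equal initial forms. -/
theorem isMinWeight_congr {w w' : NReal Γ} {f : FormalToricRing K Γ}
    (h : initialForm w f = initialForm w' f) {m : Γ} (hm : f.coeff m ≠ 0)
    (hmin : ∀ n, f.coeff n ≠ 0 → weightHom w m ≤ weightHom w n) :
    ∀ n, f.coeff n ≠ 0 → weightHom w' m ≤ weightHom w' n := by
  refine (weight_le_of_coeff_initialForm_ne_zero (w := w') ?_).2
  rw [← h, coeff_initialForm_of_le hmin]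
  exact hm

/-- `m` is the only exponent of minimal weight in `f`. -/
def HasInitialExponent (w : NReal Γ) (f : FormalToricRing K Γ) (m : Γ) : Prop :=
  f.coeff m ≠ 0 ∧ ∀ n, f.coeff n ≠ 0 → n ≠ m → weightHom w m < weightHom w n

theorem isMonomial_initialForm_iff {w : NReal Γ} {f : FormalToricRing K Γ} :
    IsMonomial (initialForm w f) ↔ ∃ m, HasInitialExponent w f m := by
  constructor
  · rintro ⟨m, c, hc, h⟩
    have hm : (initialForm w f).coeff m ≠ 0 := by rw [h, coeff_term_same]; exact hc
    obtain ⟨hm, hmin⟩ := weight_le_of_coeff_initialForm_ne_zero hm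
    refine ⟨m, hm, fun n hn hne => (hmin n hn).lt_of_ne fun heq => ?_⟩
    have hn' : (initialForm w f).coeff n = f.coeff n :=
      coeff_initialForm_of_le fun p hp => heq ▸ hmin p hp
    rw [h, coeff_term_of_ne hne] at hn'
    exact hn hn'.symm
  · rintro ⟨m, hm, hmin⟩
    refine ⟨m, f.coeff m, hm, ?_⟩
    have hle : ∀ n, f.coeff n ≠ 0 → weightHom w m ≤ weightHom w n := by
      intro n hn
      by_cases h : n = m
      · rw [h]
      · exact (hmin n hn h).le
    ext n
    by_cases h : n = m
    · rw [h, coeff_term_same, coeff_initialForm_of_le hle]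
    · rw [coeff_term_of_ne h]
      by_contra hne
      obtain ⟨h1, h2⟩ := weight_le_of_coeff_initialForm_ne_zero hne
      exact (hmin n h1 h).not_ge (h2 m hm)

theorem IsLeading.weight_le {r : LocalMonomialOrder Γ} {v : Γ →+ ℝ} {hv : ∀ m, 0 ≤ v m}
    {f : FormalToricRing K Γ} {m : Γ} (hm : IsLeading (r.refine v hv) f m) :
    ∀ n, f.coeff n ≠ 0 → v m ≤ v n := fun n hn =>
  (hm.2 n hn).elim le_of_lt fun h => h.1.le

/-- Equal initial forms mean the same exponents of minimal weight, and the refined ordering selects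
the `r`-least of these. -/
theorem IsLeading.congr_weight {r : LocalMonomialOrder Γ} {w w' : NReal Γ} (hw : w ∈ sigma Γ)
    (hw' : w' ∈ sigma Γ) {f : FormalToricRing K Γ} (h : initialForm w f = initialForm w' f) {m : Γ}
    (hm : IsLeading (r.refine _ (weightHom_nonneg hw)) f m) :
    IsLeading (r.refine _ (weightHom_nonneg hw')) f m := by
  have hmin := isMinWeight_congr h hm.1 hm.weight_le
  refine ⟨hm.1, fun n hn => ?_⟩
  rcases (hmin n hn).lt_or_eq with hlt | heq
  · exact Or.inl hlt
  · refine Or.inr ⟨heq, ?_⟩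
    have hn' := isMinWeight_congr h.symm hn (heq ▸ hmin) m hm.1
    exact (hm.2 n hn).elim (fun hlt => absurd hn' hlt.not_ge) fun h => h.2

theorem HasInitialExponent.isLeading {w : NReal Γ} (hw : w ∈ sigma Γ) (r : LocalMonomialOrder Γ)
    {f : FormalToricRing K Γ} {m : Γ} (hm : HasInitialExponent w f m) :
    IsLeading (r.refine _ (weightHom_nonneg hw)) f m := by
  refine ⟨hm.1, fun n hn => ?_⟩
  by_cases h : n = m
  · rw [h]
    exact LocalMonomialOrder.refl _ m
  · exact Or.inl (hm.2 n hn h)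

variable [PointedAffine Γ]

/-- The homogeneous components of elements of the `w`-initial ideal are lowest components of
elements of the ideal. -/
theorem exists_mem_of_mem_weightInitialIdeal {w : NReal Γ} (hw : w ∈ sigma Γ)
    {I : Ideal (FormalToricRing K Γ)} {g : FormalToricRing K Γ} (hg : g ∈ weightInitialIdeal w I)
    (d : ℝ) :
    ∃ h ∈ I, (∀ n, weightHom w n < d → h.coeff n = 0) ∧
      ∀ n, weightHom w n = d → h.coeff n = g.coeff n := by
  classical
  induction hg using Submodule.closure_induction with
  | zero => exact ⟨0, I.zero_mem, fun _ _ => rfl, fun _ _ => rfl⟩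
  | add x y _ _ hx hy =>
    obtain ⟨h, hI, h1, h2⟩ := hx
    obtain ⟨h', hI', h1', h2'⟩ := hy
    refine ⟨h + h', I.add_mem hI hI', fun n hn => ?_, fun n hn => ?_⟩
    · rw [coeff_add, h1 n hn, h1' n hn, add_zero]
    · rw [coeff_add, coeff_add, h2 n hn, h2' n hn]
  | smul_mem a x hx =>
    obtain ⟨f, hf, rfl⟩ := hx
    by_cases h0 : f = 0
    · refine ⟨0, I.zero_mem, fun _ _ => rfl, fun n _ => ?_⟩
      have : initialForm w f = 0 := by
        ext m
        by_contra hm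
        exact (weight_le_of_coeff_initialForm_ne_zero hm).1 (h0 ▸ rfl)
      rw [this, smul_zero]
    -- Well-ordering guarantees that the minimal weight on the support of `f` is attained.
    · obtain ⟨r⟩ := (inferInstance : Nonempty (LocalMonomialOrder Γ))
      obtain ⟨m, hm, hmin⟩ := exists_isLeading (r.refine _ (weightHom_nonneg hw)) h0
      have hmin' : ∀ n, f.coeff n ≠ 0 → weightHom w m ≤ weightHom w n := fun n hn =>
        (hmin n hn).elim le_of_lt fun h => h.1.le
      -- The part of `a` of weight `d - w(f)`: times `f`, it starts in weight `d` with the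
      -- weight-`d` part of `a * initialForm w f`.
      let b : FormalToricRing K Γ :=
        ⟨fun n => if weightHom w n + weightHom w m = d then a.coeff n else 0⟩
      have hb : ∀ n, b.coeff n ≠ 0 → weightHom w n + weightHom w m = d := fun n hn => by
        by_contra h
        exact hn (if_neg h)
      refine ⟨b * f, I.mul_mem_left _ hf, fun n hn => ?_, fun n hn => ?_⟩
      · by_contra hne
        obtain ⟨x, y, rfl, hx, hy⟩ := exists_coeff_mul_ne_zero hne
        have := hb x hx
        have := hmin' y hy
        rw [map_add] at hn
        linarith
      · rw [smul_eq_mul, coeff_mul, coeff_mul]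
        refine Finset.sum_congr rfl fun p hp => ?_
        rw [PointedAffine.mem_antidiagonal] at hp
        rw [← hp, map_add] at hn
        by_cases hb' : weightHom w p.1 + weightHom w m = d
        · have h1 : b.coeff p.1 = a.coeff p.1 := if_pos hb'
          have h2 : weightHom w p.2 = weightHom w m := by linarith
          rw [h1, coeff_initialForm_of_le (m := p.2) (h2 ▸ hmin')]
        · have h1 : b.coeff p.1 = 0 := if_neg hb'
          rw [h1, zero_mul]
          by_contra hne
          have h3 := weight_le_of_coeff_initialForm_ne_zero (right_ne_zero_of_mul (Ne.symm hne))
          have := h3.2 m hm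
          have := hmin' p.2 h3.1
          exact hb' (by linarith)

/-- Extracting the component in the weight of the monomial replaces membership in an initial ideal
by a condition on one element of `I`. -/
theorem exists_isMonomial_iff {w : NReal Γ} (hw : w ∈ sigma Γ) (I : Ideal (FormalToricRing K Γ)) :
    (∃ g ∈ weightInitialIdeal w I, IsMonomial g) ↔ ∃ f ∈ I, ∃ m, HasInitialExponent w f m := by
  constructor
  · rintro ⟨_, hg, m, c, hc, rfl⟩
    obtain ⟨h, hI, h1, h2⟩ := exists_mem_of_mem_weightInitialIdeal hw hg (weightHom w m)
    refine ⟨h, hI, m, ?_, fun n hn hne => ?_⟩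
    · rw [h2 m rfl, coeff_term_same]
      exact hc
    · by_contra hlt
      rcases (not_lt.1 hlt).lt_or_eq with h | h
      · exact hn (h1 n h)
      · exact hn (by rw [h2 n h, coeff_term_of_ne hne])
  · rintro ⟨f, hf, hm⟩
    exact ⟨_, Ideal.subset_span ⟨f, hf, rfl⟩, isMonomial_initialForm_iff.2 hm⟩

/-! ### Weights with equal initial forms on a standard basis -/

/-- If two weights give the same initial forms on `G`, then the corresponding refined orderings
give the same leading exponents of the ideal. -/
theorem leadingExponents_subset_of_initialForm_eq {r : LocalMonomialOrder Γ} {w w' : NReal Γ}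
    (hw : w ∈ sigma Γ) (hw' : w' ∈ sigma Γ) {I : Ideal (FormalToricRing K Γ)}
    {G : Set (FormalToricRing K Γ)} (hsub : G ⊆ I) (hG : ∀ r, GeneratesLeading r I G)
    (h : ∀ g ∈ G, initialForm w g = initialForm w' g) :
    leadingExponents (r.refine _ (weightHom_nonneg hw)) I ⊆
      leadingExponents (r.refine _ (weightHom_nonneg hw')) I := by
  intro m hm
  obtain ⟨g, hg, a, c, hga, rfl⟩ := hG _ m hm
  exact add_mem_leadingExponents ⟨g, hsub hg, hga.congr_weight hw hw' (h g hg)⟩ c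

/-- Being the exponent of a monomial initial form of an element of the ideal depends only on the
initial forms of the elements of `G`. -/
theorem exists_hasInitialExponent_congr {w w' : NReal Γ} (hw : w ∈ sigma Γ)
    {I : Ideal (FormalToricRing K Γ)}
    {G : Set (FormalToricRing K Γ)} (hfin : G.Finite) (hsub : G ⊆ I)
    (hG : ∀ r, GeneratesLeading r I G) (hinit : ∀ g ∈ G, initialForm w g = initialForm w' g)
    {h : FormalToricRing K Γ} (hI : h ∈ I) {m : Γ} (hm : HasInitialExponent w h m) :
    ∃ h' ∈ I, HasInitialExponent w' h' m := by
  classical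
  obtain ⟨r⟩ := (inferInstance : Nonempty (LocalMonomialOrder Γ))
  obtain ⟨A, f, k, hf, hk, hle⟩ := (hG (r.refine _ (weightHom_nonneg hw))).exists_representation
    hfin hsub hI
  have hm_le : ∀ n, h.coeff n ≠ 0 → (r.refine _ (weightHom_nonneg hw)).le m n := by
    intro n hn
    by_cases hnm : n = m
    · exact hnm ▸ (r.refine _ (weightHom_nonneg hw)).refl m
    · exact Or.inl (hm.2 n hn hnm)
  have hkle : ∀ a ∈ A, ∀ n, (k a).coeff n ≠ 0 →
      weightHom w m ≤ weightHom w a + weightHom w n := fun a ha n hn => by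
    rw [← map_add]
    exact (hle m hm_le a ha n hn).elim le_of_lt fun h => h.1.le
  have hmin : ∀ a ∈ A, ∀ s, (f a).coeff s ≠ 0 → weightHom w a ≤ weightHom w s :=
    fun a ha => (hf a ha).2.weight_le
  have hmin' : ∀ a ∈ A, ∀ s, (f a).coeff s ≠ 0 → weightHom w' a ≤ weightHom w' s :=
    fun a ha => isMinWeight_congr (hinit _ (hf a ha).1) (hf a ha).2.1 (hmin a ha)
  have hiff : ∀ a ∈ A, ∀ s, (f a).coeff s ≠ 0 →
      (weightHom w s = weightHom w a ↔ weightHom w' s = weightHom w' a) := by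
    intro a ha s hs
    have ha0 := (hf a ha).2.1
    constructor
    · intro heq
      exact (isMinWeight_congr (hinit _ (hf a ha).1) hs (heq ▸ hmin a ha) a ha0).antisymm
        (hmin' a ha s hs)
    · intro heq
      exact (isMinWeight_congr (hinit _ (hf a ha).1).symm hs (heq ▸ hmin' a ha) a ha0).antisymm
        (hmin a ha s hs)
  -- Truncating the quotients in both weights at once removes terms of too small `w'`-weight. No
  -- product contributing in the weights of `m` is lost: there `n` and `s` attain their `w`-bounds,
  -- so by `hiff` `s` is also `w'`-minimal in `f a`.
  let k' : Γ → FormalToricRing K Γ := fun a => ⟨fun n =>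
    if weightHom w n + weightHom w a = weightHom w m ∧
      weightHom w' n + weightHom w' a = weightHom w' m then (k a).coeff n else 0⟩
  have hk' : ∀ a n, (k' a).coeff n ≠ 0 → weightHom w n + weightHom w a = weightHom w m ∧
      weightHom w' n + weightHom w' a = weightHom w' m := fun a n hn => by
    by_contra hc
    exact hn (if_neg hc)
  have hzero : ∀ x, (∑ a ∈ A, k' a * f a).coeff x ≠ 0 →
      ∃ a ∈ A, ∃ n s, n + s = x ∧ (k' a).coeff n ≠ 0 ∧ (f a).coeff s ≠ 0 := by
    intro x hx
    rw [coeff_sum] at hx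
    obtain ⟨a, ha, hne⟩ := Finset.exists_ne_zero_of_sum_ne_zero hx
    exact ⟨a, ha, exists_coeff_mul_ne_zero hne⟩
  have heq : ∀ x, weightHom w x = weightHom w m → weightHom w' x = weightHom w' m →
      (∑ a ∈ A, k' a * f a).coeff x = h.coeff x := by
    intro x hx hx'
    rw [hk, coeff_sum, coeff_sum]
    refine Finset.sum_congr rfl fun a ha => ?_
    rw [coeff_mul, coeff_mul]
    refine Finset.sum_congr rfl fun p hp => ?_
    rw [PointedAffine.mem_antidiagonal] at hp
    rw [← hp, map_add] at hx hx'
    by_cases hs : (f a).coeff p.2 = 0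
    · rw [hs, mul_zero, mul_zero]
    by_cases hn : (k a).coeff p.1 = 0
    · have : (k' a).coeff p.1 = 0 := by
        simp only [k', hn, ite_self]
      rw [this, hn]
    have h1 := hkle a ha _ hn
    have h2 := hmin a ha _ hs
    have h3 := (hiff a ha _ hs).1 (by linarith)
    have : (k' a).coeff p.1 = (k a).coeff p.1 := if_pos ⟨by linarith, by linarith⟩
    rw [this]
  refine ⟨∑ a ∈ A, k' a * f a, I.sum_mem fun a ha => I.mul_mem_left _ (hsub (hf a ha).1), ?_, ?_⟩
  · rw [heq m rfl rfl]
    exact hm.1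
  · intro x hx hxm
    obtain ⟨a, ha, n, s, rfl, hn, hs⟩ := hzero x hx
    have h1 := hk' a n hn
    have h2 := hmin' a ha s hs
    have hle : weightHom w' m ≤ weightHom w' (n + s) := by
      rw [map_add]; linarith
    refine hle.lt_of_ne fun hw'eq => ?_
    have h3 : weightHom w (n + s) = weightHom w m := by
      rw [map_add] at hw'eq ⊢
      have := (hiff a ha s hs).2 (by linarith)
      linarith
    rw [heq _ h3 hw'eq.symm] at hx
    exact (hm.2 _ hx hxm).ne h3.symm

/-- If `χ^m` is the initial form of some element of `I`, then every element of `I` in which `χ^m`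
is the only term with a leading exponent has initial exponent `m`. -/
theorem hasInitialExponent_of_reduced {w : NReal Γ} (hw : w ∈ sigma Γ) (r : LocalMonomialOrder Γ)
    {I : Ideal (FormalToricRing K Γ)} {h f : FormalToricRing K Γ} (hI : h ∈ I) {m : Γ}
    (hm : HasInitialExponent w h m) (hf : f ∈ I) (hfm : f.coeff m = 1)
    (hred : ∀ n ∈ leadingExponents (r.refine _ (weightHom_nonneg hw)) I, n ≠ m → f.coeff n = 0) :
    HasInitialExponent w f m := by
  have hne : f ≠ 0 := fun h0 => zero_ne_one (h0 ▸ hfm)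
  obtain ⟨l, hl⟩ := exists_isLeading (r.refine _ (weightHom_nonneg hw)) hne
  have hlm : l = m := by
    by_contra hlm
    exact hl.1 (hred l ⟨f, hf, hl⟩ hlm)
  subst hlm
  have hmin := hl.weight_le
  refine ⟨hl.1, fun n hn hnm => (hmin n hn).lt_of_ne fun heq => ?_⟩
  have hh : ∀ x, x ≠ l → weightHom w x ≤ weightHom w l → h.coeff x = 0 := by
    intro x hx hle
    by_contra hx0
    exact (hm.2 x hx0 hx).not_ge hle
  -- Cancels the term at `l` and changes no other term of weight at most that of `l`. A tie at `n`
  -- would survive, making the leading exponent of `e` a leading exponent of `I` where `f` must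
  -- vanish.
  let e : FormalToricRing K Γ := f - term 0 (h.coeff l)⁻¹ * h
  have hc (x : Γ) : e.coeff x = f.coeff x - (h.coeff l)⁻¹ * h.coeff x := by
    have := coeff_term_mul_add 0 x (h.coeff l)⁻¹ h
    rw [zero_add] at this
    rw [coeff_sub, this]
  have heI : e ∈ I := I.sub_mem hf (I.mul_mem_left _ hI)
  have hen : e.coeff n ≠ 0 := by
    rw [hc, hh n hnm heq.ge, mul_zero, sub_zero]
    exact hn
  have hel : e.coeff l = 0 := by
    rw [hc, hfm, inv_mul_cancel₀ hm.1, sub_self]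
  have he0 : e ≠ 0 := fun h0 => hen (h0 ▸ rfl)
  obtain ⟨x, hx⟩ := exists_isLeading (r.refine _ (weightHom_nonneg hw)) he0
  have hxl : x ≠ l := fun h0 => hx.1 (h0 ▸ hel)
  apply hx.1
  rw [hc, hh x hxl (heq ▸ hx.weight_le n hen), mul_zero, sub_zero]
  exact hred x ⟨e, heI, hx⟩ hxl

/-! ### Finitely many classes of weights -/

/-- A series has only finitely many initial forms. -/
theorem finite_initialForms (f : FormalToricRing K Γ) :
    ((fun w => initialForm w f) '' sigma Γ).Finite := by
  classical
  obtain ⟨A, hA, hgen⟩ := PointedAffine.exists_finset_generating {m | f.coeff m ≠ 0}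
  obtain ⟨S, hS⟩ := (AddMonoid.FG.fg_top : (⊤ : AddSubmonoid Γ).FG)
  let Φ : Set Γ × Set Γ → FormalToricRing K Γ := fun p =>
    ⟨fun m => if ∃ a ∈ p.1, ∃ c ∈ AddSubmonoid.closure p.2, m = a + c then f.coeff m else 0⟩
  refine ((A.finite_toSet.finite_subsets.prod S.finite_toSet.finite_subsets).image Φ).subset ?_
  rintro _ ⟨w, hw, rfl⟩
  -- The initial form is determined by the support generators of least weight and the semigroup
  -- generators of weight 0: its exponents are those exponents of `f` that are sums from the two.
  refine ⟨({a ∈ (A : Set Γ) | ∀ b ∈ A, weightHom w a ≤ weightHom w b},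
    {t ∈ (S : Set Γ) | weightHom w t = 0}), ⟨Set.sep_subset _ _, Set.sep_subset _ _⟩, ?_⟩
  have hcl : ∀ c : Γ, weightHom w c = 0 →
      c ∈ AddSubmonoid.closure {t ∈ (S : Set Γ) | weightHom w t = 0} := by
    intro c
    have hc : c ∈ AddSubmonoid.closure (S : Set Γ) := by rw [hS]; trivial
    induction hc using AddSubmonoid.closure_induction with
    | mem x hx => exact fun h0 => AddSubmonoid.subset_closure ⟨hx, h0⟩
    | zero => exact fun _ => AddSubmonoid.zero_mem _
    | add x y _ _ hx hy =>
      intro h0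
      rw [map_add] at h0
      have h1 := weightHom_nonneg hw x
      have h2 := weightHom_nonneg hw y
      exact AddSubmonoid.add_mem _ (hx (by linarith)) (hy (by linarith))
  have hcl0 : ∀ c ∈ AddSubmonoid.closure {t ∈ (S : Set Γ) | weightHom w t = 0},
      weightHom w c = 0 := by
    intro c hc
    have : AddSubmonoid.closure {t ∈ (S : Set Γ) | weightHom w t = 0} ≤
      AddMonoidHom.mker (weightHom w) := (AddSubmonoid.closure_le).2 fun t ht => ht.2
    exact this hc
  ext m
  by_cases hm0 : f.coeff m = 0
  · have : (initialForm w f).coeff m = 0 := by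
      by_contra hne
      exact (weight_le_of_coeff_initialForm_ne_zero hne).1 hm0
    rw [this]
    simp only [Φ, hm0, ite_self]
  refine if_congr ⟨?_, fun hmin => ?_⟩ rfl rfl
  · rintro ⟨a, ⟨-, ha⟩, c, hc, rfl⟩ n hn
    obtain ⟨b, hb, d, rfl⟩ := hgen n hn
    change weightHom w (a + c) ≤ weightHom w (b + d)
    rw [map_add, map_add, hcl0 c hc]
    have := ha b hb
    have := weightHom_nonneg hw d
    linarith
  · obtain ⟨a, ha, c, rfl⟩ := hgen m hm0
    have h1 : weightHom w (a + c) ≤ weightHom w a := hmin a (hA ha)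
    rw [map_add] at h1
    have h2 := weightHom_nonneg hw c
    have h3 : weightHom w c = 0 := by linarith
    refine ⟨a, ⟨ha, fun b hb => ?_⟩, c, hcl c h3, rfl⟩
    have h4 : weightHom w (a + c) ≤ weightHom w b := hmin b (hA hb)
    rw [map_add] at h4
    linarith

/-- A finite set of series has only finitely many families of initial forms. -/
theorem finite_initialForm_families {G : Set (FormalToricRing K Γ)} (hfin : G.Finite) :
    ((fun w (g : G) => initialForm w (g : FormalToricRing K Γ)) '' sigma Γ).Finite := by
  have := hfin.to_subtype
  refine (Set.Finite.pi' fun g : G => finite_initialForms (g : FormalToricRing K Γ)).subset ?_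
  rintro _ ⟨w, hw, rfl⟩ g
  exact ⟨w, hw, rfl⟩

/-- Finitely many elements of `I` detect all weights whose initial ideal contains a monomial. -/
theorem exists_finite_detecting (I : Ideal (FormalToricRing K Γ)) {G : Set (FormalToricRing K Γ)}
    (hfin : G.Finite) (hsub : G ⊆ I) (hG : ∀ r, GeneratesLeading r I G) :
    ∃ F : Set (FormalToricRing K Γ), F.Finite ∧ F ⊆ I ∧ ∀ w ∈ sigma Γ, ∀ h ∈ I, ∀ m,
      HasInitialExponent w h m → ∃ f ∈ F, ∃ m, HasInitialExponent w f m := by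
  classical
  obtain ⟨r⟩ := (inferInstance : Nonempty (LocalMonomialOrder Γ))
  let p : NReal Γ → G → FormalToricRing K Γ := fun w g => initialForm w (g : FormalToricRing K Γ)
  have key : ∀ q : G → FormalToricRing K Γ, ∃ f ∈ I, ∀ w ∈ sigma Γ, p w = q → ∀ h ∈ I, ∀ m,
      HasInitialExponent w h m → ∃ m, HasInitialExponent w f m := by
    intro q
    by_cases hq : ∃ w ∈ sigma Γ, p w = q ∧ ∃ h ∈ I, ∃ m, HasInitialExponent w h m
    · obtain ⟨w, hw, hpw, h, hI, m, hm⟩ := hq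
      obtain ⟨f, hf, hfm, hred⟩ := exists_reduced
        (r := r.refine _ (weightHom_nonneg hw)) ⟨h, hI, hm.isLeading hw r⟩
      refine ⟨f, hf, fun w' hw' hpw' _ _ _ _ => ⟨m, ?_⟩⟩
      have hinit : ∀ g ∈ G, initialForm w g = initialForm w' g := fun g hg =>
        congrFun (hpw.trans hpw'.symm) ⟨g, hg⟩
      obtain ⟨h', hI', hm'⟩ := exists_hasInitialExponent_congr hw hfin hsub hG hinit hI hm
      exact hasInitialExponent_of_reduced hw' r hI' hm' hf hfm fun n hn =>
        hred n (leadingExponents_subset_of_initialForm_eq hw' hw hsub hG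
          (fun g hg => (hinit g hg).symm) hn)
    · push Not at hq
      exact ⟨0, I.zero_mem, fun w hw hpw h hI m hm => absurd hm (hq w hw hpw h hI m)⟩
  choose f hfI hf using key
  refine ⟨f '' (p '' sigma Γ), (finite_initialForm_families hfin).image f, ?_, ?_⟩
  · rintro _ ⟨q, -, rfl⟩
    exact hfI q
  · exact fun w hw h hI m hm =>
      ⟨f (p w), ⟨_, ⟨w, hw, rfl⟩, rfl⟩, hf (p w) w hw rfl h hI m hm⟩

end FormalToricRing

theorem mainTheorem3 {K : Type*} [Field K] {Γ : Type*} [AddCommMonoid Γ] [PointedAffine Γ]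
    (I : Ideal (FormalToricRing K Γ)) :
    ∃ B : Set (FormalToricRing K Γ), FormalToricRing.IsTropicalBasis I B := by
  obtain ⟨G, hGfin, hGsub, hG⟩ := FormalToricRing.exists_finite_generatesLeading I
  obtain ⟨F, hFfin, hFsub, hF⟩ := FormalToricRing.exists_finite_detecting I hGfin hGsub hG
  have hfin := hGfin.union hFfin
  have hsub : G ∪ F ⊆ I := Set.union_subset hGsub hFsub
  -- Enlarging `G` inside `I` keeps it a universal standard basis, and members of `I` can only
  -- witness monomials that are already in the initial ideal.
  refine ⟨G ∪ F, ⟨hfin, hsub, fun r =>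
    ((hG r).mono Set.subset_union_left).isStandardBasis hfin hsub⟩, fun w hw => ?_⟩
  rw [FormalToricRing.exists_isMonomial_iff hw]
  simp only [FormalToricRing.isMonomial_initialForm_iff]
  constructor
  · rintro ⟨h, hI, m, hm⟩
    obtain ⟨f, hf, hfm⟩ := hF w hw h hI m hm
    exact ⟨f, Or.inr hf, hfm⟩
  · rintro ⟨f, hf, hfm⟩
    exact ⟨f, hsub hf, hfm⟩
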